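/- Let $\mathbb T$ be the unit circle in $\mathbb C$ and $\mathbb T_+=\{z\in\mathbb T:\operatorname{Re} z\ge 0\}$. For an abelian group $G$ with a group topology $\tau$, let $(G,\tau)^\wedge$ be the group of $\tau$-continuous homomorphisms $G\to\mathbb T$. A set $M\subseteq G$ is quasi-convex in $(G,\tau)$ if for every $x\in G\setminus M$ there is $\varphi\in(G,\tau)^\wedge$ with $\varphi(M)\subseteq\mathbb T_+$ and $\varphi(x)\notin\mathbb T_+$. The topology $\tau$ is locally quasi-convex if it is Hausdorff and has a basis of neighbourhoods of $0$ consisting of quasi-convex sets. A locally quasi-convex group topology $\tau$ on $G$ is Mackey if every locally quasi-convex group topology $\nu$ on $G$ with $(G,\nu)^\wedge=(G,\tau)^\wedge$ is coarser than or equal to $\tau$. The group $G$ is bounded if $mG=0$ for some integer $m\ge 1$. Theorem. If $G$ is an unbounded abelian group, then there exists a metrizable locally quasi-convex group topology on $G$ which is not Mackey. -/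

import Mathlib

/-- An abelian group is bounded if it is annihilated by some positive integer. -/
def IsBoundedGroup (G : Type*) [AddCommGroup G] : Prop :=
  ∃ m : ℕ, 0 < m ∧ ∀ x : G, m • x = 0

/-- The closed right half `𝕋₊` of the unit circle. -/
def circlePlus : Set Circle :=
  {z | 0 ≤ (z : ℂ).re}

namespace AddGroupTopology

variable {G : Type*} [AddCommGroup G]

/-- The dual group of `(G, τ)`: all `τ`-continuous homomorphisms from `G` to the unit circle,
as a subset of `Hom(G, 𝕋)`. -/
def dual (τ : AddGroupTopology G) : Set (AddChar G Circle) :=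
  {φ | @Continuous G Circle τ.toTopologicalSpace inferInstance φ}

/-- Two group topologies are compatible if they have the same dual group. -/
def Compatible (τ ν : AddGroupTopology G) : Prop :=
  τ.dual = ν.dual

/-- `M` is quasi-convex in `(G, τ)` if every point outside `M` can be separated from `M`
by a continuous character. -/
def IsQuasiConvex (τ : AddGroupTopology G) (M : Set G) : Prop :=
  ∀ x, x ∉ M → ∃ φ ∈ τ.dual, (∀ y ∈ M, φ y ∈ circlePlus) ∧ φ x ∉ circlePlus

/-- `τ` is locally quasi-convex: it is Hausdorff and the quasi-convex neighbourhoods of `0`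
form a neighbourhood basis at `0`. -/
def IsLocallyQuasiConvex (τ : AddGroupTopology G) : Prop :=
  @T2Space G τ.toTopologicalSpace ∧
    ∀ U ∈ @nhds G τ.toTopologicalSpace 0,
      ∃ M ∈ @nhds G τ.toTopologicalSpace 0, τ.IsQuasiConvex M ∧ M ⊆ U

/-- `τ` is a metrizable topology. -/
def IsMetrizable (τ : AddGroupTopology G) : Prop :=
  @TopologicalSpace.MetrizableSpace G τ.toTopologicalSpace

/-- `τ` is a Mackey topology: it is locally quasi-convex, and it is the finest among all
locally quasi-convex group topologies on `G` compatible with it. In Mathlib's order on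
topologies `τ ≤ ν` says that `τ` is finer than `ν`. -/
def IsMackey (τ : AddGroupTopology G) : Prop :=
  τ.IsLocallyQuasiConvex ∧
    ∀ ν : AddGroupTopology G, ν.IsLocallyQuasiConvex → ν.Compatible τ → τ ≤ ν

end AddGroupTopology

/-! The model is the group of null sequences in ℝ/ℤ: the topologies of pointwise and of uniform
convergence are different, yet have the same continuous characters. A copy of this situation is
found inside `G`: a subgroup `H` and characters `χ j` that tend to 0 pointwise on `H`, separate its
points, and map `H` onto a uniformly dense approximation of the finitely supported sequences
(`HasDenseRange`). Declaring `H` open and using pointwise or uniform convergence of the `χ j` on `H`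
gives two locally quasi-convex topologies. The pointwise one is metrizable and strictly coarser, so
it is not Mackey once the duals agree.

Equality of duals (`pointwise_continuous_of_uniform_continuous`) is a gliding hump argument. If `φ`
is continuous for the uniform topology only, there are uniformly small humps with almost disjoint
supports on which `‖φ‖` is bounded below. Summed with suitable signs, they stay uniformly small
while `‖φ‖` grows past its maximum 1/2.

Unboundedness enters only in `exists_dense_of_not_isBoundedGroup`: the characters are built along
multiples of one element of infinite order or, in a torsion group, along elements of ever larger
order modulo the preceding ones. -/

open Filter
open scoped Topology

/-! ### Norm estimates in ℝ/ℤ. -/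

namespace UnitAddCircle

lemma exists_coe_eq_abs_eq_norm (a : UnitAddCircle) : ∃ r : ℝ, (r : UnitAddCircle) = a ∧ |r| = ‖a‖ := by
  obtain ⟨x, rfl⟩ := QuotientAddGroup.mk_surjective a
  refine ⟨x - round x, ?_, (UnitAddCircle.norm_eq (x := x)).symm⟩
  rw [AddCircle.coe_sub]
  have : ((round x : ℝ) : UnitAddCircle) = 0 := by
    rw [AddCircle.coe_eq_zero_iff]; exact ⟨round x, by simp⟩
  rw [this, sub_zero]

lemma norm_coe_eq_abs {r : ℝ} (h : |r| ≤ 1 / 2) : ‖(r : UnitAddCircle)‖ = |r| :=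
  (AddCircle.norm_coe_eq_abs_iff 1 one_ne_zero).2 (by simpa using h)

lemma norm_le_half (a : UnitAddCircle) : ‖a‖ ≤ 1 / 2 := by
  simpa using AddCircle.norm_le_half_period 1 (x := a) one_ne_zero

/-- Among `a + b` and `a - b`, one has norm `‖a‖ + ‖b‖`, for small `a` and `b`. -/
lemma norm_add_or_norm_sub {a b : UnitAddCircle} (h : ‖a‖ + ‖b‖ ≤ 1 / 2) :
    ‖a + b‖ = ‖a‖ + ‖b‖ ∨ ‖a - b‖ = ‖a‖ + ‖b‖ := by
  obtain ⟨r, rfl, hr⟩ := exists_coe_eq_abs_eq_norm a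
  obtain ⟨s, rfl, hs⟩ := exists_coe_eq_abs_eq_norm b
  rw [← hr, ← hs] at h ⊢
  rw [← AddCircle.coe_add, ← AddCircle.coe_sub]
  have key : |r + s| = |r| + |s| ∨ |r - s| = |r| + |s| := by
    rcases abs_cases r with ⟨h1, _⟩ | ⟨h1, _⟩ <;> rcases abs_cases s with ⟨h2, _⟩ | ⟨h2, _⟩ <;>
      rw [h1, h2]
    · left; rw [abs_of_nonneg (by linarith)]
    · right; rw [abs_of_nonneg (by linarith)]; ring
    · right; rw [abs_of_nonpos (by linarith)]; ring
    · left; rw [abs_of_nonpos (by linarith)]; ring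
  rcases key with k | k
  · left; rw [norm_coe_eq_abs (by linarith), k]
  · right; rw [norm_coe_eq_abs (by linarith), k]

lemma norm_two_nsmul {a : UnitAddCircle} (h : ‖a‖ ≤ 1 / 4) : ‖2 • a‖ = 2 * ‖a‖ := by
  obtain ⟨r, rfl, hr⟩ := exists_coe_eq_abs_eq_norm a
  rw [← hr] at h ⊢
  have e : |2 * r| = 2 * |r| := by rw [abs_mul, abs_two]
  rw [← AddCircle.coe_nsmul, nsmul_eq_mul, Nat.cast_ofNat, norm_coe_eq_abs (by linarith), e]

/-- Doubling is exact on norms up to 1/4, so no wrap-around occurs in the first `n` doublings. -/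
lemma norm_le_of_forall_two_pow {a : UnitAddCircle} {n : ℕ}
    (h : ∀ i ≤ n, ‖2 ^ i • a‖ ≤ 1 / 4) : ‖a‖ ≤ 1 / 4 / 2 ^ n := by
  have key : ∀ i ≤ n, ‖2 ^ i • a‖ = 2 ^ i * ‖a‖ := by
    intro i
    induction i with
    | zero => simp
    | succ i ih =>
      intro hi
      rw [pow_succ', mul_smul, norm_two_nsmul (h i (by omega)), ih (by omega)]; ring
  have := h n le_rfl
  rw [key n le_rfl] at this
  rw [le_div_iff₀ (by positivity)]; linarith

lemma norm_two_pow_nsmul_le {a : UnitAddCircle} {n : ℕ} (h : ‖a‖ ≤ 1 / 4 / 2 ^ n)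
    {i : ℕ} (hi : i ≤ n) : ‖2 ^ i • a‖ ≤ 1 / 4 := by
  refine (norm_nsmul_le (n := 2 ^ i) (a := a)).trans ?_
  rw [le_div_iff₀ (by positivity)] at h
  have : (2 : ℝ) ^ i ≤ 2 ^ n := pow_le_pow_right₀ (by norm_num) hi
  push_cast
  nlinarith [norm_nonneg a]

lemma eq_zero_of_forall_two_pow {a : UnitAddCircle} (h : ∀ i, ‖2 ^ i • a‖ ≤ 1 / 4) : a = 0 := by
  by_contra ha
  obtain ⟨n, hn⟩ := pow_unbounded_of_one_lt (1 / 4 / ‖a‖) (one_lt_two (α := ℝ))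
  have h0 : 0 < ‖a‖ := norm_pos_iff.2 ha
  have := norm_le_of_forall_two_pow (n := n) fun i _ => h i
  rw [le_div_iff₀ (by positivity)] at this
  rw [div_lt_iff₀ h0] at hn
  linarith

lemma exists_nsmul_eq (a : UnitAddCircle) {m : ℕ} (hm : 0 < m) :
    ∃ r : UnitAddCircle, m • r = a ∧ m * ‖r‖ = ‖a‖ := by
  obtain ⟨r, rfl, hr⟩ := exists_coe_eq_abs_eq_norm a
  have hm' : (0 : ℝ) < m := by exact_mod_cast hm
  have hm1 : (1 : ℝ) ≤ m := by exact_mod_cast hm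
  have hle := norm_le_half (r : UnitAddCircle)
  refine ⟨((r / m : ℝ) : UnitAddCircle), ?_, ?_⟩
  · rw [← AddCircle.coe_nsmul, nsmul_eq_mul]; congr 1; field_simp
  · have e : |r / m| = |r| / m := by rw [abs_div, abs_of_pos hm']
    have : |r| / m ≤ |r| := div_le_self (abs_nonneg _) hm1
    rw [norm_coe_eq_abs (by linarith), e, ← hr]; field_simp

lemma exists_nsmul_one_div_sub_le (a : UnitAddCircle) {m : ℕ} (hm : 0 < m) :
    ∃ k : ℕ, ‖k • (((1 / m : ℝ)) : UnitAddCircle) - a‖ ≤ 1 / m := by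
  obtain ⟨r, rfl, hr⟩ : ∃ r : ℝ, (r : UnitAddCircle) = a ∧ 0 ≤ r := by
    obtain ⟨x, rfl⟩ := QuotientAddGroup.mk_surjective a
    refine ⟨Int.fract x, ?_, Int.fract_nonneg x⟩
    rw [← Int.self_sub_floor, AddCircle.coe_sub]
    refine sub_eq_self.2 ?_
    rw [AddCircle.coe_eq_zero_iff]; exact ⟨⌊x⌋, by simp⟩
  have hm' : (0 : ℝ) < m := by exact_mod_cast hm
  refine ⟨⌊m * r⌋₊, ?_⟩
  rw [← AddCircle.coe_nsmul, ← AddCircle.coe_sub, nsmul_eq_mul]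
  have h1 := Nat.floor_le (a := m * r) (by positivity)
  have h2 := Nat.lt_floor_add_one (m * r)
  refine (QuotientAddGroup.norm_mk_le_norm).trans ?_
  rw [Real.norm_eq_abs, abs_le]
  have e : (⌊m * r⌋₊ : ℝ) * (1 / m) - r = (⌊m * r⌋₊ - m * r) / m := by field_simp
  rw [e, le_div_iff₀ hm', div_le_iff₀ hm']
  constructor
  · have : -(1 / (m : ℝ)) * m = -1 := by field_simp
    linarith
  · have : (1 / (m : ℝ)) * m = 1 := by field_simp
    linarith

lemma toCircle_mem_circlePlus (a : UnitAddCircle) : AddCircle.toCircle a ∈ circlePlus ↔ ‖a‖ ≤ 1 / 4 := by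
  obtain ⟨r, rfl, hr⟩ := exists_coe_eq_abs_eq_norm a
  have hle := norm_le_half (r : UnitAddCircle)
  rw [← hr] at hle ⊢
  rw [circlePlus, Set.mem_ofPred_eq, AddCircle.toCircle_apply_mk, Circle.coe_exp,
    Complex.exp_ofReal_mul_I_re, div_one, ← Real.cos_abs, abs_mul, abs_of_pos Real.two_pi_pos]
  have hpi := Real.pi_pos
  constructor
  · intro h
    by_contra! hc
    exact absurd h (not_le.2 (Real.cos_neg_of_pi_div_two_lt_of_lt (by nlinarith) (by nlinarith)))
  · intro h
    exact Real.cos_nonneg_of_neg_pi_div_two_le_of_le (by nlinarith [abs_nonneg r]) (by nlinarith)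

end UnitAddCircle

/-! ### Extension of characters from subgroups. -/

section Characters

variable {G : Type*} [AddCommGroup G]

/-- The hypothesis makes `t` the image of `x` under a character of the cyclic subgroup it generates
in `G ⧸ F`; divisibility of ℝ/ℤ extends that character. -/
lemma exists_hom_unitAddCircle (F : AddSubgroup G) (x : G) (t : UnitAddCircle)
    (h : ∀ k : ℤ, k • x ∈ F → k • t = 0) :
    ∃ χ : G →+ UnitAddCircle, (∀ y ∈ F, χ y = 0) ∧ χ x = t := by
  let f : ℤ →+ G ⧸ F := zmultiplesHom _ (QuotientAddGroup.mk x : G ⧸ F)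
  have hf : f.ker ≤ (zmultiplesHom UnitAddCircle t).ker := by
    intro k hk
    rw [AddMonoidHom.mem_ker, zmultiplesHom_apply] at hk ⊢
    rw [← QuotientAddGroup.mk_zsmul, QuotientAddGroup.eq_zero_iff] at hk
    exact h k hk
  obtain ⟨ψ, hψ⟩ := (Module.Baer.of_divisible UnitAddCircle).extension_property_addMonoidHom
    (QuotientAddGroup.kerLift f) (QuotientAddGroup.kerLift_injective f)
    (QuotientAddGroup.lift f.ker (zmultiplesHom UnitAddCircle t) hf)
  refine ⟨ψ.comp (QuotientAddGroup.mk' F), fun y hy => ?_, ?_⟩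
  · simp [(QuotientAddGroup.eq_zero_iff y).2 hy]
  · have := DFunLike.congr_fun hψ (QuotientAddGroup.mk (1 : ℤ))
    simpa [f] using this

/-- A point of order `m` modulo `F` is mapped to `1 / m` by some character vanishing on `F`. -/
lemma exists_hom_unitAddCircle_one_div (F : AddSubgroup G) (x : G) :
    ∃ χ : G →+ UnitAddCircle, (∀ y ∈ F, χ y = 0) ∧
      χ x = ((1 / addOrderOf (QuotientAddGroup.mk x : G ⧸ F) : ℝ) : UnitAddCircle) := by
  refine exists_hom_unitAddCircle F x _ fun k hk => ?_
  rw [← QuotientAddGroup.eq_zero_iff, QuotientAddGroup.mk_zsmul, ← addOrderOf_dvd_iff_zsmul_eq_zero] at hk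
  obtain ⟨c, rfl⟩ := hk
  rw [← AddCircle.coe_zsmul, AddCircle.coe_eq_zero_iff]
  set m := addOrderOf (QuotientAddGroup.mk x : G ⧸ F)
  rcases eq_or_ne m 0 with h0 | h0
  · exact ⟨0, by simp [h0]⟩
  · exact ⟨c, by simp; field_simp⟩

lemma exists_hom_unitAddCircle_large {F : AddSubgroup G} {x : G} (hx : x ∉ F) :
    ∃ χ : G →+ UnitAddCircle, (∀ y ∈ F, χ y = 0) ∧ 1 / 4 < ‖χ x‖ := by
  obtain ⟨χ, hF, hne⟩ : ∃ χ : G →+ UnitAddCircle, (∀ y ∈ F, χ y = 0) ∧ χ x ≠ 0 := by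
    -- Order 0 means infinite order; there `1 / m` is 0 and the value 1/2 is prescribed instead.
    rcases eq_or_ne (addOrderOf (QuotientAddGroup.mk x : G ⧸ F)) 0 with h0 | h0
    · obtain ⟨χ, h1, h2⟩ := exists_hom_unitAddCircle F x ((1 / 2 : ℝ) : UnitAddCircle) fun k hk => by
        rw [← QuotientAddGroup.eq_zero_iff, QuotientAddGroup.mk_zsmul,
          ← addOrderOf_dvd_iff_zsmul_eq_zero, h0] at hk
        have hk0 : k = 0 := by simpa using hk
        rw [hk0, zero_smul]
      refine ⟨χ, h1, fun h => ?_⟩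
      have := UnitAddCircle.norm_coe_eq_abs (r := 1 / 2) (by norm_num [abs_of_pos])
      rw [← h2, h, norm_zero, abs_of_pos (by norm_num)] at this
      norm_num at this
    · obtain ⟨χ, h1, h2⟩ := exists_hom_unitAddCircle_one_div F x
      refine ⟨χ, h1, fun h => ?_⟩
      set m := addOrderOf (QuotientAddGroup.mk x : G ⧸ F)
      have hm1 : m ≠ 1 := fun h1 => hx ((QuotientAddGroup.eq_zero_iff x).1
        (AddMonoid.addOrderOf_eq_one_iff.1 h1))
      have h2m : (2 : ℝ) ≤ m := by exact_mod_cast (show 2 ≤ m by omega)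
      have hpos : (0 : ℝ) < 1 / m := by positivity
      have := UnitAddCircle.norm_coe_eq_abs (r := 1 / m) (by
        rw [abs_of_pos hpos]; exact one_div_le_one_div_of_le (by norm_num) h2m)
      rw [← h2, h, norm_zero, abs_of_pos hpos] at this
      linarith
  by_contra! hc
  -- The characters `2 ^ i • χ` also vanish on `F`, and a nonzero value leaves the ball of radius
  -- 1/4 under repeated doubling.
  refine hne (UnitAddCircle.eq_zero_of_forall_two_pow fun i => ?_)
  have := hc (2 ^ i • χ) fun y hy => by simp [hF y hy]
  simpa using this

end Characters

/-! ### Gliding humps: equality of the two duals. -/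

section Duality

variable {G : Type*} [AddCommGroup G] {H : AddSubgroup G} {χ : ℕ → G →+ UnitAddCircle}

/-- The sequences `(χ j x)ⱼ`, `x ∈ H`, are uniformly dense in the finitely supported ones. -/
def HasDenseRange (H : AddSubgroup G) (χ : ℕ → G →+ UnitAddCircle) : Prop :=
  ∀ (d : ℕ → UnitAddCircle) (N : ℕ), (∀ j ≥ N, d j = 0) → ∀ ε > 0, ∃ x ∈ H, ∀ j, ‖χ j x - d j‖ ≤ ε

/-- Produces one hump. An `x` that is small before `N` but has `‖φ x‖ > η` is also small beyond some
`N'`. Dividing its coordinates between them by `m` makes it uniformly small, at the cost of a factor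
about `m` in `φ`. The bound `c` does not depend on `N` and `δ`, so humps can be accumulated. -/
lemma exists_small_block (hχ : ∀ x ∈ H, Tendsto (fun j => χ j x) atTop (𝓝 0))
    (hd : HasDenseRange H χ) {φ : G →+ UnitAddCircle}
    (hφ : ∀ η > 0, ∃ ε > 0, ∀ x ∈ H, (∀ j, ‖χ j x‖ ≤ ε) → ‖φ x‖ ≤ η)
    {η : ℝ} (hη : 0 < η) (hnot : ∀ N, ∀ δ > 0, ∃ x ∈ H, (∀ j < N, ‖χ j x‖ ≤ δ) ∧ η < ‖φ x‖)
    {ε : ℝ} (hε : 0 < ε) :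
    ∃ c > 0, ∀ N, ∀ δ > 0, ∃ y ∈ H, ∃ N' ≥ N, (∀ j, ‖χ j y‖ ≤ ε) ∧
      (∀ j < N, ‖χ j y‖ ≤ δ) ∧ (∀ j ≥ N', ‖χ j y‖ ≤ δ) ∧ c ≤ ‖φ y‖ := by
  obtain ⟨m, hm⟩ := exists_nat_gt (1 / ε)
  have hm0 : 0 < m := by
    have : (0 : ℝ) < m := lt_trans (by positivity) hm
    exact_mod_cast this
  have hmR : (0 : ℝ) < m := by exact_mod_cast hm0
  have hmε : 1 / (m : ℝ) < ε := by
    rw [div_lt_iff₀ hε] at hm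
    rw [div_lt_iff₀ hmR]; linarith
  refine ⟨η / 2 / m, by positivity, fun N δ₀ hδ₀ => ?_⟩
  obtain ⟨ε₂, hε₂, hφ₂⟩ := hφ (η / 2) (by positivity)
  -- `δ + m * δ` bounds every coordinate of `x - m • y`, so that `φ` moves by at most `η / 2`.
  obtain ⟨δ, hδ, h1, h2, h3⟩ : ∃ δ > 0, δ ≤ δ₀ ∧ δ ≤ ε / 2 ∧ δ + m * δ ≤ ε₂ := by
    refine ⟨min δ₀ (min (ε / 2) (ε₂ / (1 + m))), by positivity, min_le_left _ _,
      (min_le_right _ _).trans (min_le_left _ _), ?_⟩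
    have : min δ₀ (min (ε / 2) (ε₂ / (1 + m))) ≤ ε₂ / (1 + m) :=
      (min_le_right _ _).trans (min_le_right _ _)
    rw [le_div_iff₀ (by positivity)] at this
    linarith
  obtain ⟨x, hxH, hxN, hx⟩ := hnot N δ hδ
  obtain ⟨N', hN'⟩ : ∃ N', ∀ j ≥ N', ‖χ j x‖ ≤ δ := by
    have := (tendsto_zero_iff_norm_tendsto_zero.1 (hχ x hxH)).eventually (ge_mem_nhds hδ)
    simpa using this
  choose r hr hr' using fun j => UnitAddCircle.exists_nsmul_eq (χ j x) hm0
  let d : ℕ → UnitAddCircle := fun j => if N ≤ j ∧ j < N' then r j else 0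
  obtain ⟨y, hyH, hy⟩ := hd d N' (fun j hj => if_neg (by omega)) δ hδ
  have hout : ∀ j, ¬ (N ≤ j ∧ j < N') → ‖χ j y‖ ≤ δ := by
    intro j hj
    have := hy j
    simpa [d, if_neg hj] using this
  have hin : ∀ j, (N ≤ j ∧ j < N') → ‖χ j y - r j‖ ≤ δ := by
    intro j hj
    have := hy j
    simpa only [d, if_pos hj] using this
  refine ⟨y, hyH, max N N', le_max_left _ _, fun j => ?_, fun j hj => (hout j (by omega)).trans h1,
    fun j hj => (hout j (by omega)).trans h1, ?_⟩
  · by_cases hj : N ≤ j ∧ j < N'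
    · have hrj : ‖r j‖ ≤ ε / 2 := by
        have := UnitAddCircle.norm_le_half (χ j x)
        rw [← hr' j] at this
        rw [div_lt_iff₀ hmR] at hmε
        nlinarith [norm_nonneg (r j)]
      calc ‖χ j y‖ = ‖(χ j y - r j) + r j‖ := by rw [sub_add_cancel]
        _ ≤ ‖χ j y - r j‖ + ‖r j‖ := norm_add_le _ _
        _ ≤ ε := by linarith [hin j hj]
    · linarith [hout j hj]
  · have hclose : ‖φ (x - m • y)‖ ≤ η / 2 := by
      refine hφ₂ _ (H.sub_mem hxH (H.nsmul_mem hyH m)) fun j => ?_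
      refine le_trans ?_ h3
      rw [map_sub, map_nsmul]
      by_cases hj : N ≤ j ∧ j < N'
      · rw [← hr j, ← nsmul_sub]
        refine norm_nsmul_le.trans ?_
        rw [norm_sub_rev]
        nlinarith [hin j hj]
      · refine (norm_sub_le _ _).trans (add_le_add ?_ (norm_nsmul_le.trans ?_))
        · rcases lt_or_ge j N with h | h
          · exact hxN j h
          · exact hN' j (by omega)
        · exact mul_le_mul_of_nonneg_left (hout j hj) hmR.le
    have h4 : ‖φ x‖ ≤ ‖φ (x - m • y)‖ + m * ‖φ y‖ := by
      calc ‖φ x‖ = ‖φ (x - m • y) + m • φ y‖ := by simp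
        _ ≤ _ := (norm_add_le _ _).trans (add_le_add le_rfl norm_nsmul_le)
    rw [div_le_iff₀ hmR]
    linarith

/-- A character which is continuous for uniform convergence of the `χ j` on a dense family is
already continuous for pointwise convergence. -/
theorem pointwise_continuous_of_uniform_continuous
    (hχ : ∀ x ∈ H, Tendsto (fun j => χ j x) atTop (𝓝 0))
    (hd : HasDenseRange H χ) {φ : G →+ UnitAddCircle}
    (hφ : ∀ η > 0, ∃ ε > 0, ∀ x ∈ H, (∀ j, ‖χ j x‖ ≤ ε) → ‖φ x‖ ≤ η) {η : ℝ} (hη : 0 < η) :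
    ∃ N, ∃ δ > 0, ∀ x ∈ H, (∀ j < N, ‖χ j x‖ ≤ δ) → ‖φ x‖ ≤ η := by
  by_contra! hnot
  obtain ⟨ε, hε, hφε⟩ := hφ (1 / 4) (by norm_num)
  obtain ⟨c, hc, hblock⟩ := exists_small_block hχ hd hφ hη hnot (half_pos hε)
  obtain ⟨K, hK⟩ := exists_nat_gt (1 / c)
  have hK0 : (0 : ℝ) < K := lt_trans (by positivity) hK
  -- At each coordinate at most one of the `K` humps exceeds `δ`, and it is at most `ε / 2`; the
  -- total is at most `ε / 2 + K * δ = ε`. Meanwhile `K * c > 1`.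
  set δ := ε / 2 / K with hδdef
  have hδ : 0 < δ := by positivity
  have hKδ : K * δ = ε / 2 := by rw [hδdef]; field_simp
  have key : ∀ k ≤ K, ∃ z ∈ H, ∃ N, (∀ j < N, ‖χ j z‖ ≤ ε / 2 + k * δ) ∧
      (∀ j ≥ N, ‖χ j z‖ ≤ k * δ) ∧ k * c ≤ ‖φ z‖ := by
    intro k
    induction k with
    | zero => exact fun _ => ⟨0, H.zero_mem, 0, by simp, by simp, by simp⟩
    | succ k ih =>
      intro hk
      obtain ⟨z, hz, N, hz1, hz2, hz3⟩ := ih (by omega)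
      obtain ⟨y, hy, N', hN', hy1, hy2, hy3, hy4⟩ := hblock N δ hδ
      have hkδ : k * δ ≤ ε / 2 := by
        rw [← hKδ]
        exact mul_le_mul_of_nonneg_right (by exact_mod_cast (by omega : k ≤ K)) hδ.le
      have hφz : ‖φ z‖ ≤ 1 / 4 := hφε z hz fun j => by
        rcases lt_or_ge j N with h | h
        · linarith [hz1 j h]
        · linarith [hz2 j h]
      have hφy : ‖φ y‖ ≤ 1 / 4 := hφε y hy fun j => by linarith [hy1 j]
      have hfst : ∀ j < N', ‖χ j z‖ + ‖χ j y‖ ≤ ε / 2 + (k + 1) * δ := by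
        intro j hj
        rcases lt_or_ge j N with h | h
        · linarith [hz1 j h, hy2 j h]
        · linarith [hz2 j h, hy1 j]
      have hsnd : ∀ j ≥ N', ‖χ j z‖ + ‖χ j y‖ ≤ (k + 1) * δ := by
        intro j hj
        linarith [hz2 j (hN'.trans hj), hy3 j hj]
      push_cast
      -- Both values of `φ` have norm at most 1/4, so one choice of sign adds the norms exactly.
      rcases UnitAddCircle.norm_add_or_norm_sub (a := φ z) (b := φ y) (by linarith) with h | h
      · refine ⟨z + y, H.add_mem hz hy, N', fun j hj => ?_, fun j hj => ?_, ?_⟩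
        · rw [map_add]; exact (norm_add_le _ _).trans (hfst j hj)
        · rw [map_add]; exact (norm_add_le _ _).trans (hsnd j hj)
        · rw [map_add, h]; linarith
      · refine ⟨z - y, H.sub_mem hz hy, N', fun j hj => ?_, fun j hj => ?_, ?_⟩
        · rw [map_sub]; exact (norm_sub_le _ _).trans (hfst j hj)
        · rw [map_sub]; exact (norm_sub_le _ _).trans (hsnd j hj)
        · rw [map_sub, h]; linarith
  obtain ⟨z, -, -, -, -, hz⟩ := key K le_rfl
  have := UnitAddCircle.norm_le_half (φ z)
  rw [div_lt_iff₀ hc] at hK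
  linarith

end Duality

/-- A sequence of finitely supported targets visiting every finitely supported sequence
infinitely often, up to small errors. -/
lemma exists_dense_targets : ∃ D : ℕ → ℕ → UnitAddCircle, (∀ i j, i ≤ j → D i j = 0) ∧
    ∀ (d : ℕ → UnitAddCircle) (N : ℕ), (∀ j ≥ N, d j = 0) → ∀ ε > 0, ∀ k, ∃ i ≥ k,
      ∀ j, ‖D i j - d j‖ ≤ ε := by
  -- The second component repeats each finite code infinitely often; `q 0 = 0` lets the default
  -- value of a `Finsupp` encode the zero tail.
  obtain ⟨e, he⟩ := exists_surjective_nat ((ℕ →₀ ℕ) × ℕ)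
  let q : ℕ → UnitAddCircle := fun n => if n = 0 then 0 else TopologicalSpace.denseSeq UnitAddCircle (n - 1)
  refine ⟨fun i j => if j < i then q ((e i).1 j) else 0, fun i j h => if_neg (by omega), ?_⟩
  intro d N hd ε hε k
  have hq : ∀ a : UnitAddCircle, ∃ n, (a = 0 → n = 0) ∧ ‖q n - a‖ ≤ ε := by
    intro a
    by_cases ha : a = 0
    · exact ⟨0, fun _ => rfl, by simp [q, ha, hε.le]⟩
    · obtain ⟨n, hn⟩ := Metric.denseRange_iff.1 (TopologicalSpace.denseRange_denseSeq UnitAddCircle) a ε hε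
      refine ⟨n + 1, fun h => absurd h ha, ?_⟩
      rw [dist_comm, dist_eq_norm] at hn
      simpa [q] using hn.le
  choose n hn0 hn using hq
  let f : ℕ →₀ ℕ := Finsupp.onFinset (Finset.range N) (fun j => n (d j)) fun j hj => by
    by_contra h
    exact hj (hn0 _ (hd j (by simpa using h)))
  have hinf : (Set.range fun l : ℕ => ((f, l) : (ℕ →₀ ℕ) × ℕ)).Infinite :=
    Set.infinite_range_of_injective fun a b h => (Prod.mk.inj h).2
  have hpre : (e ⁻¹' Set.range fun l : ℕ => ((f, l) : (ℕ →₀ ℕ) × ℕ)).Infinite :=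
    hinf.preimage (by rw [he.range_eq]; exact Set.subset_univ _)
  obtain ⟨i, ⟨l, hl⟩, hi⟩ := hpre.exists_gt (max k N)
  refine ⟨i, by omega, fun j => ?_⟩
  have hfj : (e i).1 j = n (d j) := by rw [← hl]; rfl
  by_cases hj : j < i
  · simp only [if_pos hj, hfj]; exact hn _
  · simp [if_neg hj, hd j (by omega), hε.le]

/-! ### Dense families of characters: elements of infinite order. -/

section Construction

variable {G : Type*} [AddCommGroup G]

lemma hasDenseRange_of_targets {H : AddSubgroup G} {χ : ℕ → G →+ UnitAddCircle} {g : ℕ → G}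
    {D : ℕ → ℕ → UnitAddCircle} (hD : ∀ (d : ℕ → UnitAddCircle) (N : ℕ), (∀ j ≥ N, d j = 0) →
      ∀ ε > 0, ∀ k, ∃ i ≥ k, ∀ j, ‖D i j - d j‖ ≤ ε) (hg : ∀ i, g i ∈ H)
    (h : ∀ i j, ‖χ j (g i) - D i j‖ ≤ (1 / 2) ^ i) : HasDenseRange H χ := by
  intro d N hd ε hε
  obtain ⟨k, hk⟩ := exists_pow_lt_of_lt_one (half_pos hε) (by norm_num : (1 / 2 : ℝ) < 1)
  obtain ⟨i, hi, hDi⟩ := hD d N hd (ε / 2) (half_pos hε) k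
  refine ⟨g i, hg i, fun j => ?_⟩
  have h1 : ((1 : ℝ) / 2) ^ i ≤ (1 / 2) ^ k := pow_le_pow_of_le_one (by norm_num) (by norm_num) hi
  calc ‖χ j (g i) - d j‖ = ‖(χ j (g i) - D i j) + (D i j - d j)‖ := by rw [sub_add_sub_cancel]
    _ ≤ _ := norm_add_le _ _
    _ ≤ ε := by linarith [h i j, hDi j]

/-- For a lacunary sequence of integers, multiples of one point approximate any targets. -/
lemma exists_lacunary_approx (c : ℕ → UnitAddCircle) (j : ℕ) (hc : ∀ i ≤ j, c i = 0) :
    ∃ t : UnitAddCircle, ‖t‖ ≤ (1 / 2) ^ j ∧ ∀ i, ‖2 ^ (i ^ 2) • t - c i‖ ≤ (1 / 2) ^ i := by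
  choose r hr hr' using fun (i : ℕ) (a : UnitAddCircle) =>
    UnitAddCircle.exists_nsmul_eq a (show 0 < 2 ^ (i ^ 2) by positivity)
  -- Each step corrects `t` so that the `i`-th target is hit exactly. The correction has norm at
  -- most `1 / 2 / 2 ^ (i ^ 2)`, and the squares in the exponents keep later corrections negligible
  -- even after multiplication by `2 ^ (i ^ 2)`.
  let t : ℕ → UnitAddCircle := fun n =>
    Nat.rec 0 (fun i t => t + r i (c i - 2 ^ (i ^ 2) • t)) n
  have hstep : ∀ i, t (i + 1) = t i + r i (c i - 2 ^ (i ^ 2) • t i) := fun i => rfl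
  have hexact : ∀ i, 2 ^ (i ^ 2) • t (i + 1) = c i := by
    intro i
    rw [hstep, smul_add, hr, add_sub_cancel]
  have hdist : ∀ i, dist (t i) (t (i + 1)) ≤ 1 / 2 / 2 ^ (i ^ 2) := by
    intro i
    rw [dist_comm, dist_eq_norm, hstep, add_sub_cancel_left, le_div_iff₀ (by positivity)]
    have := hr' i (c i - 2 ^ (i ^ 2) • t i)
    push_cast at this
    linarith [UnitAddCircle.norm_le_half (c i - 2 ^ (i ^ 2) • t i)]
  have hzero : ∀ i ≤ j + 1, t i = 0 := by
    intro i
    induction i with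
    | zero => exact fun _ => rfl
    | succ i ih =>
      intro hi
      rw [hstep, ih (by omega), hc i (by omega), smul_zero, sub_zero, zero_add]
      have := hr' i 0
      rw [norm_zero] at this
      exact norm_eq_zero.1 ((mul_eq_zero.1 this).resolve_left (by positivity))
  have hpow : ∀ i l : ℕ, (2 : ℝ) ^ (i ^ 2) * (1 / 2 / 2 ^ ((i + 1 + l) ^ 2)) ≤ (1 / 2) ^ i / 2 / 2 ^ l := by
    intro i l
    rw [mul_div_assoc', div_le_div_iff₀ (by positivity) (by positivity), one_div, inv_pow,
      div_eq_mul_inv _ (2 : ℝ), mul_assoc, mul_assoc, inv_mul_eq_div ((2 : ℝ) ^ i),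
      le_div_iff₀ (by positivity)]
    have : (2 : ℝ) ^ (i ^ 2) * 2 ^ l * 2 ^ i ≤ 2 ^ ((i + 1 + l) ^ 2) := by
      rw [← pow_add, ← pow_add]
      exact pow_le_pow_right₀ (by norm_num) (by nlinarith)
    linarith
  have hcau : CauchySeq t := by
    refine cauchySeq_of_le_geometric_two (C := 1) fun i => (hdist i).trans ?_
    gcongr
    · norm_num
    · exact Nat.le_self_pow (by norm_num) i
  obtain ⟨a, ha⟩ := cauchySeq_tendsto_of_complete hcau
  have hlim : ∀ i, Tendsto (fun l => t (i + 1 + l)) atTop (𝓝 a) := fun i => by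
    simpa [add_comm] using (tendsto_add_atTop_iff_nat (i + 1)).2 ha
  refine ⟨a, ?_, fun i => ?_⟩
  · have := dist_le_of_le_geometric_two_of_tendsto₀ (C := (1 / 2) ^ j)
      (f := fun l => t (j + 1 + l)) (fun l => ?_) (hlim j)
    · simpa [hzero (j + 1) le_rfl] using this
    · refine (hdist _).trans (le_trans ?_ (hpow j l))
      exact le_mul_of_one_le_left (by positivity) (one_le_pow₀ (by norm_num))
  · have := dist_le_of_le_geometric_two_of_tendsto₀ (C := (1 / 2) ^ i)
      (f := fun l => 2 ^ (i ^ 2) • t (i + 1 + l)) (fun l => ?_) ((hlim i).const_smul (2 ^ (i ^ 2)))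
    · rwa [add_zero, hexact, dist_comm, dist_eq_norm] at this
    · refine le_trans ?_ (hpow i l)
      rw [dist_eq_norm, ← smul_sub]
      refine norm_nsmul_le.trans ?_
      push_cast
      refine mul_le_mul_of_nonneg_left ?_ (by positivity)
      rw [← dist_eq_norm]
      exact hdist (i + 1 + l)

/-- The points `2 ^ (i ^ 2) • g` realise the targets. Since `D i j = 0` for `i ≤ j`, the values `t j
= χ j g` tend to 0, which gives nullity on all multiples of `g`. -/
lemma exists_dense_of_infinite_order {g : G} (hg : ∀ k : ℤ, k • g = 0 → k = 0) :
    ∃ (H : AddSubgroup G) (χ : ℕ → G →+ UnitAddCircle),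
      (∀ x ∈ H, Tendsto (fun j => χ j x) atTop (𝓝 0)) ∧
      (∀ x ∈ H, (∀ j, χ j x = 0) → x = 0) ∧ HasDenseRange H χ := by
  obtain ⟨D, hD0, hD⟩ := exists_dense_targets
  choose t ht ht' using fun j => exists_lacunary_approx (fun i => D i j) j (fun i hi => hD0 i j hi)
  choose χ _ hχ using fun j => exists_hom_unitAddCircle ⊥ g (t j) (fun k hk => by
    rw [hg k (by simpa using hk), zero_smul])
  have hdense : HasDenseRange (AddSubgroup.zmultiples g) χ := by
    refine hasDenseRange_of_targets (g := fun i => 2 ^ (i ^ 2) • g) hD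
      (fun i => AddSubgroup.nsmul_mem _ (AddSubgroup.mem_zmultiples g) _) fun i j => ?_
    rw [map_nsmul, hχ]
    exact ht' j i
  refine ⟨AddSubgroup.zmultiples g, χ, ?_, ?_, hdense⟩
  · rintro _ ⟨k, rfl⟩
    have h0 : Tendsto t atTop (𝓝 0) := squeeze_zero_norm ht
      (tendsto_pow_atTop_nhds_zero_of_lt_one (by norm_num) (by norm_num))
    simpa [hχ] using h0.const_smul k
  · rintro _ ⟨k, rfl⟩ hk
    have hkt : k • χ 0 g = 0 := by simpa using hk 0
    suffices k = 0 by simp [this]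
    by_contra hk0
    have hn : 0 < k.natAbs := Int.natAbs_pos.2 hk0
    have hkn : k.natAbs • χ 0 g = 0 := by
      rcases Int.natAbs_eq k with h | h <;> rw [h] at hkt <;> simpa using hkt
    -- If `k` killed `χ 0 g`, it would kill `χ 0` on all of `H`; but density approximates an `a`
    -- with `|k| • a = 1/2`, closely enough that the error times `|k|` is at most 1/4.
    obtain ⟨a, ha, -⟩ := UnitAddCircle.exists_nsmul_eq ((1 / 2 : ℝ) : UnitAddCircle) hn
    have hnR : (0 : ℝ) < k.natAbs := by exact_mod_cast hn
    obtain ⟨_, ⟨l, rfl⟩, hl⟩ := hdense (fun j => if j = 0 then a else 0) 1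
      (fun j hj => if_neg (by omega)) (1 / 4 / k.natAbs) (by positivity)
    have h1 := hl 0
    have h2 : ‖k.natAbs • (χ 0 (l • g) - a)‖ ≤ 1 / 4 := by
      refine norm_nsmul_le.trans ?_
      rw [le_div_iff₀ hnR] at h1
      simpa [mul_comm] using h1
    rw [smul_sub, map_zsmul, smul_comm, hkn, smul_zero, zero_sub, norm_neg, ha,
      UnitAddCircle.norm_coe_eq_abs (by norm_num [abs_of_pos]), abs_of_pos (by norm_num)] at h2
    norm_num at h2

end Construction

/-! ### Dense families of characters: torsion groups. -/

section Construction

variable {G : Type*} [AddCommGroup G]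

/-- In an unbounded torsion group, there are a chain of subgroups `F n` and elements `g n` of large
finite order modulo `F n`, with `F (n + 1)` generated by `F n` and `g n`. -/
lemma exists_chain_of_torsion (hG : ¬ IsBoundedGroup G) (ht : ∀ x : G, ∃ k : ℕ, 0 < k ∧ k • x = 0) :
    ∃ (F : ℕ → AddSubgroup G) (g : ℕ → G), F 0 = ⊥ ∧
      (∀ n, F (n + 1) = F n ⊔ AddSubgroup.zmultiples (g n)) ∧
      ∀ n, 2 ^ n ≤ addOrderOf (QuotientAddGroup.mk (g n) : G ⧸ F n) := by
  -- `U F` says that `G ⧸ F` is unbounded; in a torsion group this survives adjoining one element.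
  let U : AddSubgroup G → Prop := fun F => ∀ m : ℕ, 0 < m → ∃ x : G, m • x ∉ F
  have hbot : U ⊥ := by
    intro m hm
    by_contra! h
    exact hG ⟨m, hm, fun x => by simpa using h x⟩
  have hsup : ∀ F, U F → ∀ g, U (F ⊔ AddSubgroup.zmultiples g) := by
    intro F hF g m hm
    obtain ⟨k, hk, hkg⟩ := ht g
    obtain ⟨x, hx⟩ := hF (k * m) (Nat.mul_pos hk hm)
    refine ⟨x, fun hmem => hx ?_⟩
    obtain ⟨y, hy, _, ⟨l, rfl⟩, hyz⟩ := AddSubgroup.mem_sup.1 hmem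
    have : (k * m) • x = k • y := by
      rw [mul_smul, ← hyz, smul_add]
      simp [smul_comm k l g, hkg]
    rw [this]
    exact F.nsmul_mem hy k
  have hstep : ∀ (n : ℕ) (F : AddSubgroup G), U F →
      ∃ g : G, 2 ^ n ≤ addOrderOf (QuotientAddGroup.mk g : G ⧸ F) := by
    intro n F hF
    -- Every positive order below `2 ^ n` divides `(2 ^ n)!`, so it would put this multiple of `x`
    -- in `F`.
    obtain ⟨x, hx⟩ := hF (2 ^ n).factorial (Nat.factorial_pos _)
    refine ⟨x, ?_⟩
    by_contra! hlt
    set m := addOrderOf (QuotientAddGroup.mk x : G ⧸ F) with hm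
    have hmx : m • x ∈ F := by
      rw [← QuotientAddGroup.eq_zero_iff, QuotientAddGroup.mk_nsmul, hm, addOrderOf_nsmul_eq_zero]
    have hmpos : 0 < m := by
      obtain ⟨k, hk, hkx⟩ := ht x
      refine addOrderOf_pos_iff.2 (isOfFinAddOrder_iff_nsmul_eq_zero.2 ⟨k, hk, ?_⟩)
      rw [← QuotientAddGroup.mk_nsmul, hkx, QuotientAddGroup.mk_zero]
    obtain ⟨c, hc⟩ := Nat.dvd_factorial hmpos hlt.le
    exact hx (by rw [hc, mul_comm, mul_smul]; exact F.nsmul_mem hmx c)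
  choose! γ hγ using hstep
  let S : ℕ → {F : AddSubgroup G // U F} := fun n =>
    Nat.rec ⟨⊥, hbot⟩ (fun n F => ⟨F.1 ⊔ AddSubgroup.zmultiples (γ n F.1), hsup F.1 F.2 _⟩) n
  exact ⟨fun n => (S n).1, fun n => γ n (S n).1, rfl, fun n => rfl, fun n => hγ n _ (S n).2⟩

/-- The conditions at `g i` are met one at a time by adding characters that vanish on `F i`;
compactness of the space of functions `G → ℝ/ℤ` then gives one character meeting all of them. -/
lemma exists_hom_approx {F : ℕ → AddSubgroup G} {g : ℕ → G}
    (hF : ∀ n, F (n + 1) = F n ⊔ AddSubgroup.zmultiples (g n))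
    (hm : ∀ n, 2 ^ n ≤ addOrderOf (QuotientAddGroup.mk (g n) : G ⧸ F n))
    (c : ℕ → UnitAddCircle) (j : ℕ) :
    ∃ χ : G →+ UnitAddCircle, (∀ x ∈ F j, χ x = 0) ∧
      χ (g j) = ((1 / addOrderOf (QuotientAddGroup.mk (g j) : G ⧸ F j) : ℝ) : UnitAddCircle) ∧
      ∀ i, j < i → ‖χ (g i) - c i‖ ≤ (1 / 2) ^ i := by
  have hmono : Monotone F := monotone_nat_of_le_succ fun n => by rw [hF n]; exact le_sup_left
  have hgF : ∀ n, g n ∈ F (n + 1) := fun n => by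
    rw [hF n]; exact AddSubgroup.mem_sup_right (AddSubgroup.mem_zmultiples _)
  set t : UnitAddCircle := ((1 / addOrderOf (QuotientAddGroup.mk (g j) : G ⧸ F j) : ℝ) : UnitAddCircle)
  let C : ℕ → Set (G → UnitAddCircle) := fun n => {χ | (∀ x y, χ (x + y) = χ x + χ y) ∧
    (∀ x ∈ F j, χ x = 0) ∧ χ (g j) = t ∧ ∀ i, j < i → i < n → ‖χ (g i) - c i‖ ≤ (1 / 2) ^ i}
  have hclosed : ∀ n, IsClosed (C n) := by
    intro n
    simp only [C, Set.ofPred_and, Set.ofPred_forall]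
    refine IsClosed.inter (isClosed_iInter fun x => isClosed_iInter fun y => ?_)
      (IsClosed.inter (isClosed_iInter fun x => isClosed_iInter fun _ => ?_)
      (IsClosed.inter ?_ (isClosed_iInter fun i => isClosed_iInter fun _ =>
        isClosed_iInter fun _ => ?_)))
    · exact isClosed_eq (by fun_prop) (by fun_prop)
    · exact isClosed_eq (by fun_prop) (by fun_prop)
    · exact isClosed_eq (by fun_prop) (by fun_prop)
    · exact isClosed_le (by fun_prop) (by fun_prop)
  have hne : ∀ n, ∃ χ : G →+ UnitAddCircle, ⇑χ ∈ C n := by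
    intro n
    induction n with
    | zero =>
      obtain ⟨χ, h1, h2⟩ := exists_hom_unitAddCircle_one_div (F j) (g j)
      exact ⟨χ, map_add χ, h1, h2, fun i _ hi => absurd hi (by omega)⟩
    | succ n ih =>
      obtain ⟨χ, h0, h1, h2, h3⟩ := ih
      rcases le_or_gt n j with hn | hn
      · exact ⟨χ, h0, h1, h2, fun i hi hi' => absurd hi' (by omega)⟩
      -- Multiples of `θ` leave the values at earlier `g i` unchanged, and their values at `g n` run
      -- through the multiples of `1 / m` with `m ≥ 2 ^ n`, which come within `(1 / 2) ^ n` of any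
      -- target.
      obtain ⟨θ, hθ, hθg⟩ := exists_hom_unitAddCircle_one_div (F n) (g n)
      have hmn : 0 < addOrderOf (QuotientAddGroup.mk (g n) : G ⧸ F n) :=
        lt_of_lt_of_le (by positivity) (hm n)
      obtain ⟨k, hk⟩ := UnitAddCircle.exists_nsmul_one_div_sub_le (c n - χ (g n)) hmn
      have hθF : ∀ i < n, θ (g i) = 0 := fun i hi => hθ _ (hmono (show i + 1 ≤ n from hi) (hgF i))
      refine ⟨χ + k • θ, map_add _, fun x hx => ?_, ?_, fun i hi hi' => ?_⟩
      · simp [h1 x hx, hθ x (hmono hn.le hx)]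
      · simp [h2, hθF j hn]
      · rcases Nat.lt_succ_iff_lt_or_eq.1 hi' with h | rfl
        · simpa [hθF i h] using h3 i hi h
        · have e : (χ + k • θ) (g i) - c i = k • θ (g i) - (c i - χ (g i)) := by
            simp only [AddMonoidHom.add_apply, AddMonoidHom.nsmul_apply]; abel
          rw [e, hθg]
          refine hk.trans ?_
          rw [one_div_pow]
          exact one_div_le_one_div_of_le (by positivity) (by exact_mod_cast hm i)
  obtain ⟨χ, hχ⟩ := IsCompact.nonempty_iInter_of_sequence_nonempty_isCompact_isClosed C
    (fun n χ h => ⟨h.1, h.2.1, h.2.2.1, fun i hi hi' => h.2.2.2 i hi (by omega)⟩)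
    (fun n => let ⟨χ, h⟩ := hne n; ⟨χ, h⟩) (hclosed 0).isCompact hclosed
  rw [Set.mem_iInter] at hχ
  exact ⟨AddMonoidHom.mk' χ (hχ 0).1, (hχ 0).2.1, (hχ 0).2.2.1,
    fun i hi => (hχ (i + 1)).2.2.2 i hi (by omega)⟩

lemma exists_dense_of_torsion (hG : ¬ IsBoundedGroup G) (ht : ∀ x : G, ∃ k : ℕ, 0 < k ∧ k • x = 0) :
    ∃ (H : AddSubgroup G) (χ : ℕ → G →+ UnitAddCircle),
      (∀ x ∈ H, Tendsto (fun j => χ j x) atTop (𝓝 0)) ∧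
      (∀ x ∈ H, (∀ j, χ j x = 0) → x = 0) ∧ HasDenseRange H χ := by
  obtain ⟨F, g, hF0, hF, hm⟩ := exists_chain_of_torsion hG ht
  obtain ⟨D, hD0, hD⟩ := exists_dense_targets
  choose χ hχF hχg hχ using fun j => exists_hom_approx hF hm (fun i => D i j) j
  have hmono : Monotone F := monotone_nat_of_le_succ fun n => by rw [hF n]; exact le_sup_left
  have hgF : ∀ n, g n ∈ F (n + 1) := fun n => by
    rw [hF n]; exact AddSubgroup.mem_sup_right (AddSubgroup.mem_zmultiples _)
  have hmem : ∀ x, x ∈ ⨆ n, F n ↔ ∃ n, x ∈ F n := fun x =>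
    AddSubgroup.mem_iSup_of_directed hmono.directed_le
  refine ⟨⨆ n, F n, χ, fun x hx => ?_, fun x hx h => ?_, ?_⟩
  · obtain ⟨n, hn⟩ := (hmem x).1 hx
    refine tendsto_const_nhds.congr' ?_
    filter_upwards [eventually_ge_atTop n] with j hj
    exact (hχF j x (hmono hj hn)).symm
  · obtain ⟨n, hn⟩ := (hmem x).1 hx
    clear hx
    induction n with
    | zero => simpa [hF0] using hn
    | succ n ih =>
      refine ih ?_
      rw [hF n] at hn
      obtain ⟨y, hy, _, ⟨a, rfl⟩, rfl⟩ := AddSubgroup.mem_sup.1 hn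
      refine (F n).add_mem hy ?_
      -- `χ n` vanishes on `F n` and has value `1 / m` at `g n`, `m` being the order of `g n` modulo
      -- `F n`; so its kernel in `F (n + 1)` is `F n`, and `x` descends the chain to `F 0 = ⊥`.
      have h1 := h n
      simp only [map_add, hχF n y hy, zero_add, map_zsmul, hχg] at h1
      change a • g n ∈ F n
      rw [← QuotientAddGroup.eq_zero_iff, QuotientAddGroup.mk_zsmul, ← addOrderOf_dvd_iff_zsmul_eq_zero]
      have hpos : (addOrderOf (QuotientAddGroup.mk (g n) : G ⧸ F n) : ℝ) ≠ 0 := by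
        have : 0 < addOrderOf (QuotientAddGroup.mk (g n) : G ⧸ F n) :=
          lt_of_lt_of_le (by positivity) (hm n)
        exact_mod_cast this.ne'
      rw [← AddCircle.coe_zsmul, AddCircle.coe_eq_zero_iff] at h1
      obtain ⟨l, hl⟩ := h1
      refine ⟨l, ?_⟩
      simp only [zsmul_eq_mul, mul_one] at hl
      field_simp at hl
      rw [mul_comm]
      exact_mod_cast hl.symm
  · refine hasDenseRange_of_targets hD (g := g) (fun i => (hmem _).2 ⟨i + 1, hgF i⟩) fun i j => ?_
    rcases lt_trichotomy i j with h | rfl | h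
    · rw [hD0 i j h.le, hχF j _ (hmono (show i + 1 ≤ j from h) (hgF i))]
      simp
    · rw [hD0 i i le_rfl, hχg, sub_zero]
      refine QuotientAddGroup.norm_mk_le_norm.trans ?_
      rw [Real.norm_of_nonneg (by positivity), one_div_pow]
      exact one_div_le_one_div_of_le (by positivity) (by exact_mod_cast hm i)
    · exact hχ j i h

/-- An unbounded abelian group has a subgroup `H` and a sequence of characters, pointwise null and
separating on `H`, with dense range in the finitely supported sequences. -/
theorem exists_dense_of_not_isBoundedGroup (hG : ¬ IsBoundedGroup G) :
    ∃ (H : AddSubgroup G) (χ : ℕ → G →+ UnitAddCircle),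
      (∀ x ∈ H, Tendsto (fun j => χ j x) atTop (𝓝 0)) ∧
      (∀ x ∈ H, (∀ j, χ j x = 0) → x = 0) ∧ HasDenseRange H χ := by
  by_cases ht : ∀ x : G, ∃ k : ℕ, 0 < k ∧ k • x = 0
  · exact exists_dense_of_torsion hG ht
  · push Not at ht
    obtain ⟨g, hg⟩ := ht
    refine exists_dense_of_infinite_order (g := g) fun k hk => ?_
    by_contra hk0
    refine hg k.natAbs (Int.natAbs_pos.2 hk0) ?_
    rcases Int.natAbs_eq k with h | h <;> rw [h] at hk <;> simpa using hk

end Construction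

/-! ### Locally quasi-convex topologies defined by characters. -/

section CharacterTopology

variable {G : Type*} [AddCommGroup G]

/-- The basic neighbourhoods of `0` for the topology on `G` making `H` open and defined on `H` by
uniform convergence of the characters `χ j` on each of the sets `J n`. -/
def charNhd (H : AddSubgroup G) (χ : ℕ → G →+ UnitAddCircle) (J : ℕ → Set ℕ) (n : ℕ) : Set G :=
  {x | x ∈ H ∧ ∀ j ∈ J n, ‖χ j x‖ ≤ 1 / 4 / 2 ^ n}

lemma charNhd_anti (H : AddSubgroup G) (χ : ℕ → G →+ UnitAddCircle) {J : ℕ → Set ℕ}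
    (hJ : Monotone J) : Antitone (charNhd H χ J) := fun m n hmn x hx =>
  ⟨hx.1, fun j hj => (hx.2 j (hJ hmn hj)).trans (by gcongr; norm_num)⟩

/-- The sets `charNhd H χ J n` form a group filter basis. -/
@[reducible]
def charFilterBasis (H : AddSubgroup G) (χ : ℕ → G →+ UnitAddCircle) {J : ℕ → Set ℕ}
    (hJ : Monotone J) : AddGroupFilterBasis G :=
  addGroupFilterBasisOfComm (Set.range (charNhd H χ J)) (Set.range_nonempty _)
    (by
      rintro _ _ ⟨m, rfl⟩ ⟨n, rfl⟩
      exact ⟨_, ⟨max m n, rfl⟩, Set.subset_inter (charNhd_anti H χ hJ (le_max_left _ _))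
        (charNhd_anti H χ hJ (le_max_right _ _))⟩)
    (by
      rintro _ ⟨n, rfl⟩
      exact ⟨H.zero_mem, fun j _ => by rw [map_zero, norm_zero]; positivity⟩)
    (by
      rintro _ ⟨n, rfl⟩
      refine ⟨_, ⟨n + 1, rfl⟩, ?_⟩
      rintro _ ⟨x, hx, y, hy, rfl⟩
      refine ⟨H.add_mem hx.1 hy.1, fun j hj => ?_⟩
      have h1 := hx.2 j (hJ (Nat.le_succ n) hj)
      have h2 := hy.2 j (hJ (Nat.le_succ n) hj)
      have h3 : (1 : ℝ) / 4 / 2 ^ n = 1 / 4 / 2 ^ (n + 1) + 1 / 4 / 2 ^ (n + 1) := by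
        rw [pow_succ]; field_simp; norm_num
      rw [h3, map_add]
      exact (norm_add_le _ _).trans (add_le_add h1 h2))
    (by
      rintro _ ⟨n, rfl⟩
      exact ⟨_, ⟨n, rfl⟩, fun x hx => ⟨H.neg_mem hx.1, fun j hj => by
        rw [map_neg, norm_neg]; exact hx.2 j hj⟩⟩)

/-- The group topology with basic neighbourhoods of zero `charNhd H χ J n`. -/
def charTopology (H : AddSubgroup G) (χ : ℕ → G →+ UnitAddCircle) {J : ℕ → Set ℕ}
    (hJ : Monotone J) : AddGroupTopology G :=
  ⟨(charFilterBasis H χ hJ).topology, (charFilterBasis H χ hJ).isTopologicalAddGroup⟩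

variable (H : AddSubgroup G) (χ : ℕ → G →+ UnitAddCircle) {J : ℕ → Set ℕ} (hJ : Monotone J)

lemma charTopology_hasBasis :
    (@nhds G (charTopology H χ hJ).toTopologicalSpace 0).HasBasis (fun _ => True)
      (charNhd H χ J) := by
  refine ⟨fun U => ?_⟩
  refine (AddGroupFilterBasis.nhds_zero_hasBasis (charFilterBasis H χ hJ)).mem_iff.trans ?_
  constructor
  · rintro ⟨_, ⟨n, rfl⟩, hn⟩
    exact ⟨n, trivial, hn⟩
  · rintro ⟨n, -, hn⟩
    exact ⟨_, ⟨n, rfl⟩, hn⟩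

lemma charTopology_continuous_iff (φ : G →+ UnitAddCircle) :
    @Continuous G UnitAddCircle (charTopology H χ hJ).toTopologicalSpace inferInstance φ ↔
      ∀ η > 0, ∃ n, ∀ x ∈ charNhd H χ J n, ‖φ x‖ ≤ η := by
  let _ := (charTopology H χ hJ).toTopologicalSpace
  have := (charTopology H χ hJ).toIsTopologicalAddGroup
  have h : Continuous φ ↔ Tendsto φ (𝓝 0) (𝓝 0) :=
    ⟨fun h => by simpa using h.tendsto 0, fun h => continuous_of_continuousAt_zero φ (by
      simpa [ContinuousAt] using h)⟩
  rw [h, (charTopology_hasBasis H χ hJ).tendsto_iff Metric.nhds_basis_closedBall]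
  simp

/-- The character into the unit circle defined by a character into `ℝ / ℤ`. -/
noncomputable def AddMonoidHom.toCircleChar (φ : G →+ UnitAddCircle) : AddChar G Circle where
  toFun x := AddCircle.toCircle (φ x)
  map_zero_eq_one' := by rw [map_zero, AddCircle.toCircle_zero]
  map_add_eq_mul' x y := by rw [map_add, AddCircle.toCircle_add]

lemma AddMonoidHom.toCircleChar_apply (φ : G →+ UnitAddCircle) (x : G) :
    φ.toCircleChar x = AddCircle.toCircle (φ x) := rfl

lemma AddMonoidHom.toCircleChar_surjective :
    Function.Surjective (AddMonoidHom.toCircleChar (G := G)) := by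
  intro ψ
  let e := AddCircle.homeomorphCircle (T := 1) one_ne_zero
  have he : ∀ x, AddCircle.toCircle (e.symm (ψ x)) = ψ x := fun x => by
    rw [← AddCircle.homeomorphCircle_apply one_ne_zero]; exact e.apply_symm_apply _
  refine ⟨AddMonoidHom.mk' (fun x => e.symm (ψ x)) fun x y => ?_, ?_⟩
  · refine AddCircle.injective_toCircle one_ne_zero ?_
    rw [AddCircle.toCircle_add, he, he, he, AddChar.map_add_eq_mul]
  · ext x
    rw [AddMonoidHom.toCircleChar_apply]
    exact congrArg _ (he x)

lemma toCircleChar_mem_dual_iff (τ : AddGroupTopology G) (φ : G →+ UnitAddCircle) :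
    φ.toCircleChar ∈ τ.dual ↔
      @Continuous G UnitAddCircle τ.toTopologicalSpace inferInstance φ := by
  let _ := τ.toTopologicalSpace
  have : (φ.toCircleChar : G → Circle) =
      AddCircle.homeomorphCircle (T := 1) one_ne_zero ∘ φ := by
    ext x; simp [AddMonoidHom.toCircleChar_apply, AddCircle.homeomorphCircle_apply]
  change Continuous φ.toCircleChar ↔ _
  rw [this, Homeomorph.comp_continuous_iff]

lemma toCircleChar_mem_circlePlus_iff (φ : G →+ UnitAddCircle) (x : G) :
    φ.toCircleChar x ∈ circlePlus ↔ ‖φ x‖ ≤ 1 / 4 :=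
  UnitAddCircle.toCircle_mem_circlePlus _

/-- The bound `1 / 4 / 2 ^ n` on `χ j` amounts to the bound 1/4 on `2 ^ i • χ j` for all `i ≤ n`,
and these characters are continuous for `j ∈ J n`. Points outside `H` are separated by characters
vanishing on `H`, continuous because `H` is open. -/
lemma isQuasiConvex_charNhd (n : ℕ) :
    (charTopology H χ hJ).IsQuasiConvex (charNhd H χ J n) := by
  intro x hx
  suffices ∃ φ : G →+ UnitAddCircle, (∀ η > 0, ∃ n, ∀ y ∈ charNhd H χ J n, ‖φ y‖ ≤ η) ∧
      (∀ y ∈ charNhd H χ J n, ‖φ y‖ ≤ 1 / 4) ∧ 1 / 4 < ‖φ x‖ by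
    obtain ⟨φ, h1, h2, h3⟩ := this
    refine ⟨φ.toCircleChar, (toCircleChar_mem_dual_iff _ φ).2
      ((charTopology_continuous_iff H χ hJ φ).2 h1), fun y hy => ?_, fun h => ?_⟩
    · exact (toCircleChar_mem_circlePlus_iff φ y).2 (h2 y hy)
    · exact absurd ((toCircleChar_mem_circlePlus_iff φ x).1 h) (not_le.2 h3)
  by_cases hxH : x ∈ H
  · obtain ⟨j, hj, hjx⟩ : ∃ j ∈ J n, 1 / 4 / 2 ^ n < ‖χ j x‖ := by
      by_contra! h
      exact hx ⟨hxH, h⟩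
    obtain ⟨i, hi, hix⟩ : ∃ i ≤ n, 1 / 4 < ‖2 ^ i • χ j x‖ := by
      by_contra! h
      exact absurd (UnitAddCircle.norm_le_of_forall_two_pow h) (not_le.2 hjx)
    refine ⟨2 ^ i • χ j, fun η hη => ?_,       fun y hy => ?_, by rwa [AddMonoidHom.nsmul_apply]⟩
    · obtain ⟨k, hk⟩ := pow_unbounded_of_one_lt (2 ^ i * (1 / 4) / η) (one_lt_two (α := ℝ))
      refine ⟨max n k, fun y hy => ?_⟩
      rw [AddMonoidHom.nsmul_apply]
      refine norm_nsmul_le.trans ?_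
      have h1 := hy.2 j (hJ (le_max_left n k) hj)
      have h2 : (2 : ℝ) ^ k ≤ 2 ^ max n k := pow_le_pow_right₀ (by norm_num) (le_max_right n k)
      rw [div_lt_iff₀ hη] at hk
      rw [le_div_iff₀ (by positivity)] at h1
      push_cast
      have h3 : (2 : ℝ) ^ i * ‖χ j y‖ * 2 ^ max n k ≤ η * 2 ^ max n k := by
        have : (2 : ℝ) ^ i * (‖χ j y‖ * 2 ^ max n k) ≤ 2 ^ i * (1 / 4) := by gcongr
        nlinarith
      exact le_of_mul_le_mul_right h3 (by positivity)
    · rw [AddMonoidHom.nsmul_apply]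
      exact UnitAddCircle.norm_two_pow_nsmul_le (hy.2 j hj) hi
  · obtain ⟨φ, h1, h2⟩ := exists_hom_unitAddCircle_large hxH
    exact ⟨φ, fun η hη => ⟨0, fun y hy => by rw [h1 y hy.1, norm_zero]; exact hη.le⟩,
      fun y hy => by rw [h1 y hy.1, norm_zero]; norm_num, h2⟩

variable {H χ}

lemma t2Space_charTopology (hsep : ∀ x ∈ H, (∀ j, χ j x = 0) → x = 0)
    (hJ' : ∀ j, ∃ n, j ∈ J n) : @T2Space G (charTopology H χ hJ).toTopologicalSpace := by
  let _ := (charTopology H χ hJ).toTopologicalSpace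
  have := (charTopology H χ hJ).toIsTopologicalAddGroup
  refine IsTopologicalAddGroup.t2Space_of_zero_sep fun x hx => ?_
  by_contra! h
  have hmem : ∀ n, x ∈ charNhd H χ J n := fun n =>
    h _ ((charTopology_hasBasis H χ hJ).mem_of_mem trivial)
  refine hx (hsep x (hmem 0).1 fun j => ?_)
  obtain ⟨n, hn⟩ := hJ' j
  refine UnitAddCircle.eq_zero_of_forall_two_pow fun i => ?_
  exact UnitAddCircle.norm_two_pow_nsmul_le ((hmem (max n i)).2 j (hJ (le_max_left n i) hn))
    (le_max_right n i)

lemma isLocallyQuasiConvex_charTopology (hsep : ∀ x ∈ H, (∀ j, χ j x = 0) → x = 0)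
    (hJ' : ∀ j, ∃ n, j ∈ J n) : (charTopology H χ hJ).IsLocallyQuasiConvex := by
  refine ⟨t2Space_charTopology hJ hsep hJ', fun U hU => ?_⟩
  obtain ⟨n, -, hn⟩ := (charTopology_hasBasis H χ hJ).mem_iff.1 hU
  exact ⟨_, (charTopology_hasBasis H χ hJ).mem_of_mem trivial, isQuasiConvex_charNhd H χ hJ n, hn⟩

lemma isMetrizable_charTopology (hsep : ∀ x ∈ H, (∀ j, χ j x = 0) → x = 0)
    (hJ' : ∀ j, ∃ n, j ∈ J n) : (charTopology H χ hJ).IsMetrizable := by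
  let _ := (charTopology H χ hJ).toTopologicalSpace
  have := (charTopology H χ hJ).toIsTopologicalAddGroup
  have : T2Space G := t2Space_charTopology hJ hsep hJ'
  have : (𝓝 (0 : G)).IsCountablyGenerated :=
    (charTopology_hasBasis H χ hJ).isCountablyGenerated
  let _ := IsTopologicalAddGroup.rightUniformSpace G
  have := isUniformAddGroup_of_addCommGroup (G := G)
  have : (uniformity G).IsCountablyGenerated := IsUniformAddGroup.uniformity_countably_generated
  exact UniformSpace.metrizableSpace

end CharacterTopology

/-! ### Comparison of the pointwise and uniform topologies. -/

theorem theoremC (G : Type*) [AddCommGroup G] (hG : ¬ IsBoundedGroup G) :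
    ∃ τ : AddGroupTopology G, τ.IsMetrizable ∧ τ.IsLocallyQuasiConvex ∧ ¬ τ.IsMackey := by
  obtain ⟨H, χ, hnull, hsep, hdense⟩ := exists_dense_of_not_isBoundedGroup hG
  have hI : Monotone (fun n : ℕ => Set.Iio n) := fun _ _ h => Set.Iio_subset_Iio h
  have hU : Monotone (fun _ : ℕ => (Set.univ : Set ℕ)) := monotone_const
  have hI' : ∀ j : ℕ, ∃ n : ℕ, j ∈ Set.Iio n := fun j => ⟨j + 1, Nat.lt_succ_self j⟩
  have hU' : ∀ j : ℕ, ∃ _ : ℕ, j ∈ (Set.univ : Set ℕ) := fun _ => ⟨0, Set.mem_univ _⟩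
  refine ⟨charTopology H χ hI, isMetrizable_charTopology hI hsep hI',
    isLocallyQuasiConvex_charTopology hI hsep hI', fun hM => ?_⟩
  have hpow : ∀ ε > 0, ∃ n : ℕ, (1 : ℝ) / 4 / 2 ^ n ≤ ε := fun ε hε => by
    obtain ⟨n, hn⟩ := pow_unbounded_of_one_lt (1 / 4 / ε) (one_lt_two (α := ℝ))
    refine ⟨n, ?_⟩
    rw [div_lt_iff₀ hε] at hn
    rw [div_le_iff₀ (by positivity)]
    linarith
  have hcomp : (charTopology H χ hU).Compatible (charTopology H χ hI) := by
    refine Set.ext fun ψ => ?_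
    obtain ⟨φ, rfl⟩ := AddMonoidHom.toCircleChar_surjective ψ
    rw [toCircleChar_mem_dual_iff, toCircleChar_mem_dual_iff, charTopology_continuous_iff,
      charTopology_continuous_iff]
    constructor
    · intro h η hη
      obtain ⟨N, δ, hδ, hN⟩ := pointwise_continuous_of_uniform_continuous hnull hdense (φ := φ)
        (fun η hη => by
          obtain ⟨n, hn⟩ := h η hη
          exact ⟨1 / 4 / 2 ^ n, by positivity, fun x hx hx' => hn x ⟨hx, fun j _ => hx' j⟩⟩) hη
      obtain ⟨n, hn⟩ := hpow δ hδ
      refine ⟨max N n, fun x hx => hN x hx.1 fun j hj => ?_⟩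
      refine ((hx.2 j (lt_of_lt_of_le hj (le_max_left N n))).trans ?_).trans hn
      gcongr
      · norm_num
      · exact le_max_right N n
    · intro h η hη
      obtain ⟨n, hn⟩ := h η hη
      exact ⟨n, fun x hx => hn x ⟨hx.1, fun j _ => hx.2 j (Set.mem_univ j)⟩⟩
  have hle := hM.2 _ (isLocallyQuasiConvex_charTopology hU hsep hU') hcomp
  have hmem := nhds_mono (a := (0 : G)) hle ((charTopology_hasBasis H χ hU).mem_of_mem (i := 0) trivial)
  obtain ⟨n, -, hn⟩ := (charTopology_hasBasis H χ hI).mem_iff.1 hmem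
  -- A near copy of 1/2 at coordinate `n`: the coordinates before `n` are small enough for the
  -- pointwise neighbourhood, while `‖χ n x‖ ≥ 1/2 - 1/8 > 1/4` violates the uniform one.
  obtain ⟨x, hxH, hx⟩ := hdense (fun j => if j = n then ((1 / 2 : ℝ) : UnitAddCircle) else 0) (n + 1)
    (fun j hj => if_neg (by omega)) (min (1 / 8) (1 / 4 / 2 ^ n)) (by positivity)
  have h1 := (hn (a := x) ⟨hxH, fun j hj => ?_⟩).2 n (Set.mem_univ n)
  · have h2 := (hx n).trans (min_le_left _ _)
    have h3 := norm_sub_norm_le ((1 / 2 : ℝ) : UnitAddCircle) (χ n x)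
    rw [norm_sub_rev, UnitAddCircle.norm_coe_eq_abs (by norm_num [abs_of_pos]),
      abs_of_pos (by norm_num)] at h3
    simp only [if_true] at h2
    rw [pow_zero, div_one] at h1
    linarith
  · have h2 := (hx j).trans (min_le_right _ _)
    rwa [if_neg (ne_of_lt hj), sub_zero] at h2
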